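/- For a finite simple graph $G$, let $\mathrm{sp}(G)$ be the minimum size of a family $\mathcal P$ of paths in $G$ (a single vertex counts as a path) such that for every two distinct vertices $u,v$ of $G$ some $P\in\mathcal P$ contains exactly one of $u$ and $v$. For an integer $n\ge 1$, let $f(n)$ be the minimum non-negative integer $t$ such that every $n$-vertex graph $G$ with minimum degree at least $t$ satisfies $\mathrm{sp}(G)=\lceil\log_2 n\rceil$. Then \[\left\lceil\frac{n-1}{2}\right\rceil\le f(n)\quad\text{for every integer } n\ge 1 \text{ with } n\notin\{2,3,5\},\] and \[f(n)\le \frac n2+9\sqrt{n\log\log n}\quad\text{for every integer } n\ge 3,\] where $\log$ denotes the natural logarithm. -/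

import Mathlib

namespace VertexSep

/-- The paths of the graph `G`, with arbitrary endpoints. A single vertex is a (trivial) path. -/
abbrev GPath {V : Type*} (G : SimpleGraph V) : Type _ :=
  Σ u : V, Σ v : V, G.Path u v

/-- The vertex set `V(P)` of a path `P`. -/
def GPath.verts {V : Type*} {G : SimpleGraph V} (P : GPath G) : Set V :=
  {x | x ∈ P.2.2.1.support}

/-- A collection `𝒮` of subsets of `V` is a separating system if any two distinct elements of `V`
are separated by some member of `𝒮`, i.e. the member contains exactly one of the two. -/
def IsSeparatingSystem {V : Type*} (𝒮 : Set (Set V)) : Prop :=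
  ∀ x y : V, x ≠ y → ∃ S ∈ 𝒮, (x ∈ S ∧ y ∉ S) ∨ (x ∉ S ∧ y ∈ S)

/-- The finite family `F` of paths of `G` is a vertex-separating path system. -/
def IsVertexSeparating {V : Type*} {G : SimpleGraph V} (F : Finset (GPath G)) : Prop :=
  IsSeparatingSystem {S : Set V | ∃ P ∈ F, GPath.verts P = S}

/-- `sp(G)`: the minimum size of a vertex-separating path system of the finite graph `G`. -/
noncomputable def sp {V : Type*} (G : SimpleGraph V) : ℕ :=
  sInf {k : ℕ | ∃ F : Finset (GPath G), IsVertexSeparating F ∧ F.card = k}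

/-- Every `n`-vertex graph of minimum degree at least `t` satisfies `sp(G) = ⌈log₂ n⌉`. -/
def ForcesOptimal (n t : ℕ) : Prop :=
  ∀ (G : SimpleGraph (Fin n)) [DecidableRel G.Adj],
    t ≤ G.minDegree → sp G = ⌈Real.logb 2 (n : ℝ)⌉₊

/-- `f(n)`: the minimum `t` such that minimum degree at least `t` forces `sp(G) = ⌈log₂ n⌉` for
`n`-vertex graphs. -/
noncomputable def f (n : ℕ) : ℕ :=
  sInf {t : ℕ | ForcesOptimal n t}

/-- The minimum defining `sp` is attained on finite graphs. -/
theorem sp_spec {V : Type*} [Fintype V] (G : SimpleGraph V) :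
    IsLeast {k : ℕ | ∃ F : Finset (GPath G), IsVertexSeparating F ∧ F.card = k} (sp G) := by
  classical
  have hne : {k : ℕ | ∃ F : Finset (GPath G), IsVertexSeparating F ∧ F.card = k}.Nonempty := by
    refine ⟨_, Finset.univ.image (fun v : V => (⟨v, v, SimpleGraph.Path.nil⟩ : GPath G)), ?_, rfl⟩
    intro x y hxy
    refine ⟨{z | z = x}, ⟨⟨x, x, SimpleGraph.Path.nil⟩, by simp, ?_⟩, Or.inl ⟨rfl, ?_⟩⟩
    · ext z
      simp [GPath.verts, SimpleGraph.Path.nil]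
    · exact fun h => hxy h.symm
  exact ⟨Nat.sInf_mem hne, fun k hk => Nat.sInf_le hk⟩

/-- The minimum defining `f` is attained. -/
theorem f_spec (n : ℕ) (hn : 1 ≤ n) : IsLeast {t : ℕ | ForcesOptimal n t} (f n) := by
  have hne : {t : ℕ | ForcesOptimal n t}.Nonempty := by
    refine ⟨n, fun G _ h => ?_⟩
    have : Nonempty (Fin n) := ⟨⟨0, hn⟩⟩
    have h2 := G.minDegree_lt_card
    rw [Fintype.card_fin] at h2
    omega
  exact ⟨Nat.sInf_mem hne, fun k hk => Nat.sInf_le hk⟩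

end VertexSep

/-!
The lower bound comes from two disjoint cliques of almost equal size. Every path stays within one of
them, so cliques with `s` and `t` vertices need about `log₂ s + log₂ t` paths, whereas `⌈log₂ n⌉` is
about `1 + log₂ t` (`exists_card_bounds_of_twoCliques`, `clog_lt_sp_twoCliques`). Only for `n = 4` is
it needed that at most one vertex can be missed by all paths.

For the upper bound, `⌈log₂ n⌉` paths are necessary by counting (`clog_card_le_sp`). To see that they
suffice, the vertices are grouped into `⌈n / 2⌉` pairs, and the pairs get distinct pairs of
complementary binary words of length `k = ⌈log₂ n⌉`; a random sign for each pair decides which of its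
vertices gets which word. The words are distinct, so the sets `Sᵢ` of vertices whose `i`-th bit is
one separate the vertices, and it remains to choose the signs such that every `Sᵢ` is the vertex set
of a path. For fixed `i`, the set `Sᵢ` is a uniformly random transversal of the pairs. Hence
`2 |N(v) ∩ Sᵢ| - deg v` is a Rademacher sum with at most `⌈n / 2⌉` terms, and Hoeffding's inequality
(`card_pairSum_le`) shows that `v` has at most `n / 4` neighbours in `Sᵢ` with probability at most a
power of `1 / log n`. By the first moment method (`exists_of_card_le`) there are signs such that for
each of the `k = O(log n)` sets at most `n / 8` vertices are exceptional in this sense, while all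
vertices have more than `n / 8` neighbours in every `Sᵢ`. Applying Markov's inequality to the number
of exceptional vertices, instead of excluding them altogether, is what reduces `log n` to
`log log n`.

A graph induced on `Sᵢ` has at most `(n + 1) / 2` vertices. So all of its vertices but the
exceptional ones satisfy Dirac's condition, and the exceptional vertices have larger degree than
their number. By the closure argument of Bondy and Chvátal (`degree_add_degree_lt_of_maximal`) such a
graph has a Hamiltonian path (`traceable_of_degree`).

If `n` is small, then the claimed upper bound exceeds `n` and there is nothing to prove; otherwise
`n ≥ 500` (`six_le_log_of_lt`).
-/

namespace VertexSep

open Finset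

/-! ### Counting separated vertices -/

theorem card_le_two_pow_of_separated {V ι : Type*} (A : Finset V) (F : Finset ι)
    (r : V → ι → Prop)
    (hsep : ∀ x ∈ A, ∀ y ∈ A, x ≠ y → ∃ i ∈ F, ¬ (r x i ↔ r y i)) :
    A.card ≤ 2 ^ F.card := by
  classical
  rw [← card_powerset]
  refine card_le_card_of_injOn (fun x => F.filter (r x))
    (fun x _ => mem_coe.2 (mem_powerset.2 (filter_subset _ _))) ?_
  intro x hx y hy hxy
  by_contra hne
  obtain ⟨i, hi, h⟩ := hsep x hx y hy hne
  have := Finset.ext_iff.1 hxy i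
  simp only [mem_filter, hi, true_and] at this
  exact h this

/-- If moreover every element of `A` meets the family, the empty signature is not used. -/
theorem card_lt_two_pow_of_separated {V ι : Type*} (A : Finset V) (F : Finset ι)
    (r : V → ι → Prop)
    (hsep : ∀ x ∈ A, ∀ y ∈ A, x ≠ y → ∃ i ∈ F, ¬ (r x i ↔ r y i))
    (hcov : ∀ x ∈ A, ∃ i ∈ F, r x i) :
    A.card < 2 ^ F.card := by
  classical
  rw [← card_powerset]
  have h0 : (∅ : Finset ι) ∈ F.powerset := by simp
  refine lt_of_le_of_lt (card_le_card_of_injOn (t := F.powerset.erase ∅)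
    (fun x => F.filter (r x)) (fun x hx => ?_) ?_) (card_erase_lt_of_mem h0)
  · obtain ⟨i, hi, h⟩ := hcov x hx
    simp only [coe_erase, Set.mem_sdiff, mem_coe, mem_powerset, filter_subset, true_and,
      Set.mem_singleton_iff]
    exact ne_empty_of_mem (mem_filter.2 ⟨hi, h⟩)
  · intro x hx y hy hxy
    by_contra hne
    obtain ⟨i, hi, h⟩ := hsep x hx y hy hne
    have := Finset.ext_iff.1 hxy i
    simp only [mem_filter, hi, true_and] at this
    exact h this

theorem IsVertexSeparating.exists_not_iff {V : Type*} {G : SimpleGraph V} {F : Finset (GPath G)}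
    (hF : IsVertexSeparating F) {x y : V} (hxy : x ≠ y) :
    ∃ P ∈ F, ¬ (x ∈ P.verts ↔ y ∈ P.verts) := by
  obtain ⟨S, ⟨P, hP, rfl⟩, h⟩ := hF x y hxy
  exact ⟨P, hP, by tauto⟩

theorem clog_card_le_card {V : Type*} [Fintype V] {G : SimpleGraph V} {F : Finset (GPath G)}
    (hF : IsVertexSeparating F) : Nat.clog 2 (Fintype.card V) ≤ F.card := by
  rw [Nat.clog_le_iff_le_pow (by norm_num), ← card_univ]
  exact card_le_two_pow_of_separated univ F (fun x P => x ∈ P.verts)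
    fun x _ y _ hxy => hF.exists_not_iff hxy

theorem clog_card_le_sp {V : Type*} [Fintype V] (G : SimpleGraph V) :
    Nat.clog 2 (Fintype.card V) ≤ sp G := by
  obtain ⟨F, hF, hcard⟩ := (sp_spec G).1
  exact hcard ▸ clog_card_le_card hF

/-! ### The lower bound: two disjoint cliques -/

/-- The disjoint union of a clique on the vertices below `k` and a clique on the others. -/
def twoCliques (n k : ℕ) : SimpleGraph (Fin n) where
  Adj x y := x ≠ y ∧ ((x : ℕ) < k ↔ (y : ℕ) < k)
  symm := ⟨fun _ _ h => ⟨h.1.symm, h.2.symm⟩⟩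
  loopless := ⟨fun _ h => h.1 rfl⟩

/-- A path stays within one of the two cliques. -/
theorem twoCliques_lt_iff {n k : ℕ} {u v : Fin n} (p : (twoCliques n k).Walk u v) :
    ∀ x ∈ p.support, ((x : ℕ) < k ↔ (u : ℕ) < k) := by
  induction p with
  | nil => simp
  | cons h p ih =>
    intro x hx
    rw [SimpleGraph.Walk.support_cons, List.mem_cons] at hx
    rcases hx with rfl | hx
    · rfl
    · exact (ih x hx).trans h.2.symm

theorem le_minDegree_twoCliques {n k : ℕ} (hk : 1 ≤ k) (hkn : 2 * k ≤ n)
    [DecidableRel (twoCliques n k).Adj] : k - 1 ≤ (twoCliques n k).minDegree := by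
  classical
  have : Nonempty (Fin n) := ⟨⟨0, by omega⟩⟩
  refine SimpleGraph.le_minDegree_of_forall_le_degree _ _ fun v => ?_
  rw [← SimpleGraph.card_neighborFinset_eq_degree]
  by_cases hv : (v : ℕ) < k
  · have h := pred_card_le_card_erase (s := univ.image (Fin.castLE (by omega : k ≤ n))) (a := v)
    rw [card_image_of_injective _ (Fin.castLE_injective _), card_univ, Fintype.card_fin] at h
    refine h.trans (card_le_card fun x hx => ?_)
    simp only [mem_erase, mem_image, mem_univ, true_and] at hx
    obtain ⟨hne, a, rfl⟩ := hx
    rw [SimpleGraph.mem_neighborFinset]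
    exact ⟨hne.symm, by simp [hv]⟩
  · have h := pred_card_le_card_erase
      (s := univ.image (fun a : Fin k => (⟨k + a, by omega⟩ : Fin n))) (a := v)
    rw [card_image_of_injective _ (fun a b hab => by
      simp only [Fin.mk.injEq] at hab; omega), card_univ, Fintype.card_fin] at h
    refine h.trans (card_le_card fun x hx => ?_)
    simp only [mem_erase, mem_image, mem_univ, true_and] at hx
    obtain ⟨hne, a, rfl⟩ := hx
    rw [SimpleGraph.mem_neighborFinset]
    exact ⟨hne.symm, by simp [hv]⟩

/-- Each path lies in one clique, and at most one vertex is missed by all paths, so that one of the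
cliques is completely covered. -/
theorem exists_card_bounds_of_twoCliques {n k : ℕ} (hkn : k ≤ n)
    {F : Finset (GPath (twoCliques n k))} (hF : IsVertexSeparating F) :
    ∃ a b : ℕ, a + b = F.card ∧ k ≤ 2 ^ a ∧ n - k ≤ 2 ^ b ∧ (k < 2 ^ a ∨ n - k < 2 ^ b) := by
  classical
  let A : Finset (Fin n) := univ.filter fun x => (x : ℕ) < k
  let B : Finset (Fin n) := univ.filter fun x => ¬ (x : ℕ) < k
  let FA := F.filter fun P => (P.1 : ℕ) < k
  let FB := F.filter fun P => ¬ (P.1 : ℕ) < k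
  have hA : A.card = k := by
    simp only [A]
    rw [Fin.card_filter_val_lt]; omega
  have hAB : A.card + B.card = n := by
    rw [card_filter_add_card_filter_not, card_univ, Fintype.card_fin]
  have hB : B.card = n - k := by omega
  have key : ∀ P ∈ F, ∀ x ∈ P.verts, ((x : ℕ) < k ↔ (P.1 : ℕ) < k) :=
    fun P _ x hx => twoCliques_lt_iff P.2.2.1 x hx
  have hcovA : ∀ x ∈ A, (∃ P ∈ F, x ∈ P.verts) → ∃ P ∈ FA, x ∈ P.verts := by
    rintro x hx ⟨P, hP, h⟩
    exact ⟨P, mem_filter.2 ⟨hP, (key P hP x h).1 (mem_filter.1 hx).2⟩, h⟩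
  have hcovB : ∀ x ∈ B, (∃ P ∈ F, x ∈ P.verts) → ∃ P ∈ FB, x ∈ P.verts := by
    rintro x hx ⟨P, hP, h⟩
    exact ⟨P, mem_filter.2 ⟨hP, fun h' => (mem_filter.1 hx).2 ((key P hP x h).2 h')⟩, h⟩
  have hsepA : ∀ x ∈ A, ∀ y ∈ A, x ≠ y → ∃ P ∈ FA, ¬ (x ∈ P.verts ↔ y ∈ P.verts) := by
    intro x hx y hy hxy
    obtain ⟨P, hP, h⟩ := hF.exists_not_iff hxy
    refine ⟨P, mem_filter.2 ⟨hP, ?_⟩, h⟩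
    by_cases hxP : x ∈ P.verts
    · exact (key P hP x hxP).1 (mem_filter.1 hx).2
    · exact (key P hP y (by tauto)).1 (mem_filter.1 hy).2
  have hsepB : ∀ x ∈ B, ∀ y ∈ B, x ≠ y → ∃ P ∈ FB, ¬ (x ∈ P.verts ↔ y ∈ P.verts) := by
    intro x hx y hy hxy
    obtain ⟨P, hP, h⟩ := hF.exists_not_iff hxy
    refine ⟨P, mem_filter.2 ⟨hP, fun h' => ?_⟩, h⟩
    by_cases hxP : x ∈ P.verts
    · exact (mem_filter.1 hx).2 ((key P hP x hxP).2 h')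
    · exact (mem_filter.1 hy).2 ((key P hP y (by tauto)).2 h')
  refine ⟨FA.card, FB.card, card_filter_add_card_filter_not _, ?_, ?_, ?_⟩
  · exact hA.symm.trans_le (card_le_two_pow_of_separated A FA (fun x P => x ∈ P.verts) hsepA)
  · exact hB.symm.trans_le (card_le_two_pow_of_separated B FB (fun x P => x ∈ P.verts) hsepB)
  by_cases hcov : ∀ x ∈ A, ∃ P ∈ F, x ∈ P.verts
  · exact Or.inl (hA.symm.trans_lt (card_lt_two_pow_of_separated A FA (fun x P => x ∈ P.verts)
      hsepA fun x hx => hcovA x hx (hcov x hx)))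
  · push Not at hcov
    obtain ⟨z, hz, hzF⟩ := hcov
    refine Or.inr (hB.symm.trans_lt (card_lt_two_pow_of_separated B FB (fun x P => x ∈ P.verts)
      hsepB fun x hx => hcovB x hx ?_))
    have hne : x ≠ z := by
      rintro rfl
      exact (mem_filter.1 hx).2 (mem_filter.1 hz).2
    obtain ⟨P, hP, h⟩ := hF.exists_not_iff hne
    exact ⟨P, hP, by have := hzF P hP; tauto⟩

theorem clog_lt_sp_twoCliques {n : ℕ} (hn : 4 ≤ n) (hn5 : n ≠ 5) :
    Nat.clog 2 n < sp (twoCliques n (n / 2)) := by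
  obtain ⟨F, hF, hcard⟩ := (sp_spec (twoCliques n (n / 2))).1
  obtain ⟨a, b, hab, ha, hb, hab'⟩ := exists_card_bounds_of_twoCliques (by omega) hF
  rw [← hcard, ← hab]
  -- As `2 ^ clog₂ n < 2 * n`, it is enough to have `2 * n ≤ 2 ^ (a + b)`.
  suffices h : 2 * n ≤ 2 ^ (a + b) by
    have h1 := Nat.pow_pred_clog_lt_self (b := 2) (by norm_num) (by omega : 1 < n)
    have h2 : 2 ^ Nat.clog 2 n < 2 ^ (a + b) := by
      have h3 : 0 < Nat.clog 2 n := Nat.clog_pos (by norm_num) (by omega)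
      rw [← Nat.succ_pred_eq_of_pos h3, pow_succ]
      omega
    exact (Nat.pow_lt_pow_iff_right (by norm_num)).1 h2
  rw [pow_add]
  have two_le : ∀ c : ℕ, 3 ≤ 2 ^ c → 4 ≤ 2 ^ c := by
    intro c hc
    rcases c with _ | _ | c
    · simp at hc
    · simp at hc
    · rw [pow_add]
      have := Nat.one_le_two_pow (n := c)
      omega
  rcases Nat.lt_or_ge n 6 with h6 | h6
  · obtain rfl : n = 4 := by omega
    norm_num at ha hb hab' ⊢
    rcases hab' with h | h
    · have := two_le a h
      nlinarith
    · have := two_le b h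
      nlinarith
  · have := two_le a (by omega)
    calc 2 * n ≤ 4 * (n - n / 2) := by omega
      _ ≤ 2 ^ a * 2 ^ b := Nat.mul_le_mul this hb

theorem half_le_f {n : ℕ} (hn : 4 ≤ n) (hn5 : n ≠ 5) : n / 2 ≤ f n := by
  classical
  by_contra! hlt
  have h := (f_spec n (by omega)).1 (twoCliques n (n / 2))
    ((by omega : f n ≤ n / 2 - 1).trans (le_minDegree_twoCliques (by omega) (by omega)))
  have h2 : ⌈Real.logb 2 (n : ℝ)⌉₊ = Nat.clog 2 n := by
    exact_mod_cast Real.natCeil_logb_natCast 2 n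
  exact (clog_lt_sp_twoCliques hn hn5).ne' (h.trans h2)

theorem ceil_half_le_f {n : ℕ} (h1 : 1 ≤ n) (h2 : n ≠ 2) (h3 : n ≠ 3) (h5 : n ≠ 5) :
    ⌈((n : ℝ) - 1) / 2⌉ ≤ (f n : ℤ) := by
  rcases Nat.lt_or_ge n 4 with h4 | h4
  · obtain rfl : n = 1 := by omega
    simp
  · rw [Int.ceil_le]
    have h : n ≤ 2 * f n + 1 := by have := half_le_f h4 h5; omega
    have : (n : ℝ) ≤ 2 * f n + 1 := by exact_mod_cast h
    push_cast
    linarith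

/-! ### Hamiltonian paths -/

/-- The graph has a Hamiltonian path, given as the list of its vertices. For an empty vertex set
the empty list qualifies. -/
def Traceable {W : Type*} (H : SimpleGraph W) : Prop :=
  ∃ l : List W, l.Nodup ∧ (∀ w, w ∈ l) ∧ l.IsChain H.Adj

/-- If `deg u + deg v ≥ |l| - 1`, then a list `l` of all vertices can be cut into two parts, the
first ending in a neighbour of `u` and the second starting with a neighbour of `v`. The position `r`
of `u` is excluded, as are the last entry for `u` and the first entry for `v`, so that only
`|l| - 2` positions remain for the `deg u + deg v` neighbours. -/
theorem exists_cut_of_degree {W : Type*} [Fintype W] {H : SimpleGraph W}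
    [DecidableRel H.Adj] {u v : W} {l : List W} (hnd : l.Nodup) (hall : ∀ w, w ∈ l)
    {r : ℕ} (hr : r + 1 < l.length) (hu : l[r] = u) (hv : l[r + 1] = v)
    (hlast : ∀ x ∈ l.getLast?, ¬ H.Adj u x) (hhead : ∀ x ∈ l.head?, ¬ H.Adj v x)
    (hdeg : Fintype.card W ≤ H.degree u + H.degree v + 1) :
    ∃ P Q : List W, l = P ++ Q ∧ (∃ x ∈ P.getLast?, H.Adj u x) ∧ ∃ y ∈ Q.head?, H.Adj v y := by
  classical
  have hlen : l.length = Fintype.card W := by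
    rw [← List.toFinset_card_of_nodup hnd, ← card_univ]
    congr 1
    ext w
    simp [hall w]
  have hget : ∀ w, l[l.idxOf w]'(List.idxOf_lt_length_of_mem (hall w)) = w := fun w =>
    List.getElem_idxOf _
  have hlt : ∀ w, l.idxOf w < l.length := fun w => List.idxOf_lt_length_of_mem (hall w)
  have hinj : ∀ a c, l.idxOf a = l.idxOf c → a = c := by
    intro a c h
    rw [← hget a, ← hget c]
    simp only [h]
  have hpos : ∀ c, H.Adj v c → 0 < l.idxOf c := by
    intro c hc
    by_contra h0
    refine hhead c ?_ hc
    have := hget c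
    rw [Option.mem_def, List.head?_eq_getElem?, List.getElem?_eq_getElem (by omega)]
    simp only [show l.idxOf c = 0 by omega] at this
    rw [this]
  have hltp : ∀ c, H.Adj u c → l.idxOf c + 1 < l.length := by
    intro c hc
    by_contra h0
    refine hlast c ?_ hc
    have h1 := hget c
    have h2 := hlt c
    rw [Option.mem_def, List.getLast?_eq_getElem?, List.getElem?_eq_getElem (by omega)]
    simp only [show l.idxOf c = l.length - 1 by omega] at h1
    rw [h1]
  let I := (H.neighborFinset u).image l.idxOf
  let J := (H.neighborFinset v).image fun c => l.idxOf c - 1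
  have hI : I.card = H.degree u := by
    rw [← SimpleGraph.card_neighborFinset_eq_degree]
    exact card_image_of_injOn fun a _ c _ h => hinj a c h
  have hJ : J.card = H.degree v := by
    rw [← SimpleGraph.card_neighborFinset_eq_degree]
    refine card_image_of_injOn fun a ha c hc h => hinj a c ?_
    have h1 := hpos a (by simpa using ha)
    have h2 := hpos c (by simpa using hc)
    omega
  have hIs : I ⊆ (range (l.length - 1)).erase r := by
    intro i hi
    obtain ⟨a, ha, rfl⟩ := mem_image.1 hi
    rw [SimpleGraph.mem_neighborFinset] at ha
    have h1 := hltp a ha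
    refine mem_erase.2 ⟨fun h => ha.ne ?_, mem_range.2 (by omega)⟩
    rw [← hget a, ← hu]
    simp only [h]
  have hJs : J ⊆ (range (l.length - 1)).erase r := by
    intro i hi
    obtain ⟨a, ha, rfl⟩ := mem_image.1 hi
    rw [SimpleGraph.mem_neighborFinset] at ha
    have h1 := hpos a ha
    have h2 := hlt a
    refine mem_erase.2 ⟨fun h => ha.ne ?_, mem_range.2 (by omega)⟩
    rw [← hget a, ← hv]
    simp only [show l.idxOf a = r + 1 by omega]
  have hcard : ((range (l.length - 1)).erase r).card = l.length - 2 := by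
    rw [card_erase_of_mem (mem_range.2 (by omega)), card_range]
    omega
  have hnotdisj : ¬ Disjoint I J := by
    intro hd
    have := card_le_card (union_subset hIs hJs)
    rw [card_union_of_disjoint hd] at this
    omega
  obtain ⟨i, hi, hj⟩ := not_disjoint_iff.1 hnotdisj
  obtain ⟨a, ha, hai⟩ := mem_image.1 hi
  obtain ⟨c, hc, hci⟩ := mem_image.1 hj
  rw [SimpleGraph.mem_neighborFinset] at ha hc
  have h1 := hpos c hc
  have h2 := hlt c
  have h3 := hget a
  have h4 := hget c
  refine ⟨l.take (i + 1), l.drop (i + 1), (List.take_append_drop _ _).symm,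
    ⟨a, ?_, ha⟩, ⟨c, ?_, hc⟩⟩
  · subst hai
    have := hltp a ha
    rw [Option.mem_def, List.getLast?_take, List.getElem?_eq_getElem (by omega)]
    simp [h3]
  · rw [Option.mem_def, List.head?_drop, List.getElem?_eq_getElem (by omega)]
    simp only [show l.idxOf c = i + 1 by omega] at h4
    rw [h4]

/-- Replacing a Hamiltonian path of `H + uv` that uses `uv` by a Hamiltonian path of `H`: the path
consists of a part ending in `u` and a part starting in `v`, and reversing a segment of it next to
the edge `uv` avoids this edge. -/
theorem traceable_of_split {W : Type*} [Fintype W] {H : SimpleGraph W}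
    [DecidableRel H.Adj] {u v : W} {A B : List W}
    (hnd : ((A ++ [u]) ++ v :: B).Nodup) (hall : ∀ w, w ∈ (A ++ [u]) ++ v :: B)
    (hA : (A ++ [u]).IsChain H.Adj) (hB : (v :: B).IsChain H.Adj)
    (hdeg : Fintype.card W ≤ H.degree u + H.degree v + 1) : Traceable H := by
  have hrev : ∀ l : List W, l.IsChain H.Adj → l.reverse.IsChain H.Adj := by
    intro l hl
    rw [List.isChain_reverse]
    exact hl.imp fun _ _ h => h.symm
  have of_perm : ∀ l : List W, l.Perm ((A ++ [u]) ++ v :: B) → l.IsChain H.Adj → Traceable H :=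
    fun l hp hl => ⟨l, hp.nodup_iff.2 hnd, fun w => hp.mem_iff.2 (hall w), hl⟩
  by_cases hlast : ∀ x ∈ ((A ++ [u]) ++ v :: B).getLast?, ¬ H.Adj u x
  swap
  · push Not at hlast
    obtain ⟨x, hx, hux⟩ := hlast
    refine of_perm ((A ++ [u]) ++ (v :: B).reverse) ((List.reverse_perm _).append_left _) ?_
    refine List.isChain_append.2 ⟨hA, hrev _ hB, ?_⟩
    intro a ha c hc
    rw [List.head?_reverse] at hc
    rw [List.getLast?_append_of_ne_nil _ (by simp)] at hx
    simp only [List.getLast?_append, List.getLast?_singleton, Option.some_or, Option.mem_def,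
      Option.some.injEq] at ha
    rw [← ha, Option.mem_unique hc hx]
    exact hux
  by_cases hhead : ∀ x ∈ ((A ++ [u]) ++ v :: B).head?, ¬ H.Adj v x
  swap
  · push Not at hhead
    obtain ⟨x, hx, hvx⟩ := hhead
    refine of_perm ((A ++ [u]).reverse ++ (v :: B)) ((List.reverse_perm _).append_right _) ?_
    refine List.isChain_append.2 ⟨hrev _ hA, hB, ?_⟩
    intro a ha c hc
    rw [List.getLast?_reverse] at ha
    rw [List.head?_append_of_ne_nil _ (by simp)] at hx
    simp only [List.head?_cons, Option.mem_def, Option.some.injEq] at hc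
    rw [← hc, Option.mem_unique ha hx]
    exact hvx.symm
  obtain ⟨P, Q, hPQ, ⟨x, hx, hux⟩, y, hy, hvy⟩ :=
    exists_cut_of_degree hnd hall (r := A.length) (by simp) (by simp) (by simp) hlast hhead hdeg
  rcases List.append_eq_append_iff.1 hPQ with ⟨C, rfl, hC⟩ | ⟨C, hC, rfl⟩
  · -- The cut is behind the edge `uv`: the segment `C` from `v` to the cut is reversed.
    rcases eq_or_ne C [] with rfl | hne
    · simp only [List.append_nil, List.getLast?_append, List.getLast?_singleton, Option.some_or,
        Option.mem_def, Option.some.injEq] at hx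
      exact absurd (hx ▸ hux) (H.loopless.irrefl u)
    rw [hC] at hB of_perm
    obtain ⟨hC1, hQ1, -⟩ := List.isChain_append.1 hB
    refine of_perm ((A ++ [u]) ++ (C.reverse ++ Q))
      (((List.reverse_perm _).append_right _).append_left _) ?_
    have hCv : C.head? = some v := by
      have := congrArg List.head? hC
      rwa [List.head?_append_of_ne_nil _ hne, List.head?_cons, eq_comm] at this
    refine List.isChain_append.2 ⟨hA, List.isChain_append.2 ⟨hrev _ hC1, hQ1, ?_⟩, ?_⟩
    · intro a ha c hc
      rw [List.getLast?_reverse, hCv] at ha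
      rw [Option.mem_unique hc hy, ← Option.some.inj ha]
      exact hvy
    · intro a ha c hc
      rw [List.head?_append_of_ne_nil _ (by simpa using hne), List.head?_reverse] at hc
      rw [List.getLast?_append_of_ne_nil _ hne] at hx
      simp only [List.getLast?_append, List.getLast?_singleton, Option.some_or, Option.mem_def,
        Option.some.injEq] at ha
      rw [← ha, Option.mem_unique hc hx]
      exact hux
  · -- The cut is in front of the edge `uv`: the segment `C` from the cut to `u` is reversed.
    rcases eq_or_ne C [] with rfl | hne
    · simp only [List.nil_append, List.head?_cons, Option.mem_def, Option.some.injEq] at hy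
      exact absurd (hy ▸ hvy) (H.loopless.irrefl v)
    rw [hC] at hA of_perm
    obtain ⟨hP1, hC1, -⟩ := List.isChain_append.1 hA
    refine of_perm ((P ++ C.reverse) ++ v :: B)
      (((List.reverse_perm _).append_left _).append_right _) ?_
    have hCu : C.getLast? = some u := by
      have := congrArg List.getLast? hC
      rw [List.getLast?_append_of_ne_nil _ hne] at this
      simpa using this.symm
    refine List.isChain_append.2 ⟨List.isChain_append.2 ⟨hP1, hrev _ hC1, ?_⟩, hB, ?_⟩
    · intro a ha c hc
      rw [List.head?_reverse, hCu] at hc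
      rw [Option.mem_unique ha hx, ← Option.some.inj hc]
      exact hux.symm
    · intro a ha c hc
      rw [List.getLast?_append_of_ne_nil _ (by simpa using hne), List.getLast?_reverse] at ha
      rw [List.head?_append_of_ne_nil _ hne] at hy
      simp only [List.head?_cons, Option.mem_def, Option.some.injEq] at hc
      rw [← hc, Option.mem_unique ha hy]
      exact hvy.symm

/-- A path of `H + uv` either is a path of `H`, or it consists of two paths of `H` joined
by `uv`. -/
theorem isChain_or_exists_split {W : Type*} {H : SimpleGraph W} {u v : W} (l : List W)
    (hnd : l.Nodup) (hl : l.IsChain (H ⊔ SimpleGraph.edge u v).Adj) :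
    l.IsChain H.Adj ∨ ∃ a c A B, ((a = u ∧ c = v) ∨ (a = v ∧ c = u)) ∧
      l = (A ++ [a]) ++ c :: B ∧ (A ++ [a]).IsChain H.Adj ∧ (c :: B).IsChain H.Adj := by
  have hedge : ∀ x y, (H ⊔ SimpleGraph.edge u v).Adj x y →
      H.Adj x y ∨ ((x = u ∧ y = v) ∨ (x = v ∧ y = u)) := by
    intro x y h
    rw [SimpleGraph.sup_adj, SimpleGraph.edge_adj] at h
    tauto
  induction l with
  | nil => exact Or.inl List.isChain_nil
  | cons x l ih =>
    rw [List.nodup_cons] at hnd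
    rw [List.isChain_cons] at hl
    rcases ih hnd.2 hl.2 with h | ⟨a, c, A, B, hac, rfl, hA, hB⟩
    · by_cases hx : ∀ y ∈ l.head?, H.Adj x y
      · exact Or.inl (List.isChain_cons.2 ⟨hx, h⟩)
      · push Not at hx
        obtain ⟨y, hy, hxy⟩ := hx
        obtain ⟨B, rfl⟩ := List.head?_eq_some_iff.1 hy
        exact Or.inr ⟨x, y, [], B, (hedge x y (hl.1 y hy)).resolve_left hxy, by simp, by simp, h⟩
    · refine Or.inr ⟨a, c, x :: A, B, hac, by simp, ?_, hB⟩
      rw [List.cons_append]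
      refine List.isChain_cons.2 ⟨fun y hy => ?_, hA⟩
      rcases hedge x y (hl.1 y (by
        rw [List.head?_append_of_ne_nil _ (by simp)]; exact hy)) with h | h
      · exact h
      · exfalso
        have : x ≠ a ∧ x ≠ c := by
          constructor
          · rintro rfl; exact hnd.1 (by simp)
          · rintro rfl; exact hnd.1 (by simp)
        rcases hac with ⟨rfl, rfl⟩ | ⟨rfl, rfl⟩ <;> rcases h with h | h <;> tauto

/-- The Bondy–Chvátal closure step for Hamiltonian paths. -/
theorem degree_add_degree_lt_of_maximal {W : Type*} [Fintype W] {H : SimpleGraph W}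
    [DecidableRel H.Adj] (hH : Maximal (fun H => ¬ Traceable H) H) {u v : W} (huv : u ≠ v)
    (hadj : ¬ H.Adj u v) : H.degree u + H.degree v + 1 < Fintype.card W := by
  by_contra! hdeg
  have hlt : H < H ⊔ SimpleGraph.edge u v := by
    refine lt_of_le_of_ne le_sup_left fun h => hadj ?_
    rw [h]
    simp [SimpleGraph.edge_adj, huv]
  obtain ⟨l, hnd, hall, hch⟩ : Traceable (H ⊔ SimpleGraph.edge u v) := by
    by_contra h
    exact hlt.not_ge (hH.2 h hlt.le)
  apply hH.1
  rcases isChain_or_exists_split l hnd hch with hl | ⟨a, c, A, B, hac, rfl, hA, hB⟩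
  · exact ⟨l, hnd, hall, hl⟩
  · refine traceable_of_split hnd hall hA hB ?_
    rcases hac with ⟨rfl, rfl⟩ | ⟨rfl, rfl⟩ <;> omega

/-- All but `b` vertices satisfy the degree condition of Dirac's theorem for Hamiltonian paths, and
the remaining ones have degree at least `b`. In a maximal non-traceable graph containing `H`, the
closure step makes the former vertices a clique, then joins them to the others, and finally makes
the graph complete. -/
theorem traceable_of_degree {W : Type*} [Fintype W] (H : SimpleGraph W)
    [DecidableRel H.Adj] (b : ℕ) (hb : 2 * b ≤ Fintype.card W + 1)
    (hbad : #{w | 2 * H.degree w + 1 < Fintype.card W} ≤ b)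
    (hmin : ∀ w, b ≤ H.degree w) : Traceable H := by
  classical
  by_contra hnot
  obtain ⟨K, hHK, hK⟩ := (Set.toFinite {K : SimpleGraph W | ¬ Traceable K}).exists_le_maximal hnot
  have hore : ∀ u v, u ≠ v → Fintype.card W ≤ K.degree u + K.degree v + 1 → K.Adj u v := by
    intro u v huv h
    by_contra hadj
    exact (degree_add_degree_lt_of_maximal hK huv hadj).not_ge h
  have hle : ∀ w, H.degree w ≤ K.degree w := fun w => SimpleGraph.degree_le_of_le hHK
  set bad : Finset W := {w | 2 * H.degree w + 1 < Fintype.card W} with hbaddef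
  have hgood : ∀ w ∉ bad, Fintype.card W ≤ 2 * K.degree w + 1 := by
    intro w hw
    simp only [hbaddef, mem_filter, mem_univ, true_and, not_lt] at hw
    have := hle w
    omega
  have hcard : bad.card + badᶜ.card = Fintype.card W := card_add_card_compl bad
  have hclique : ∀ u ∉ bad, ∀ v ∉ bad, u ≠ v → K.Adj u v := by
    intro u hu v hv huv
    have := hgood u hu
    have := hgood v hv
    exact hore u v huv (by omega)
  have hgdeg : ∀ u ∉ bad, badᶜ.card ≤ K.degree u + 1 := by
    intro u hu
    have h : badᶜ ⊆ insert u (K.neighborFinset u) := by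
      intro v hv
      rw [mem_insert, SimpleGraph.mem_neighborFinset]
      by_cases huv : v = u
      · exact Or.inl huv
      · exact Or.inr (hclique u hu v (mem_compl.1 hv) (Ne.symm huv))
    exact (card_le_card h).trans (card_insert_le _ _)
  have hmix : ∀ u ∉ bad, ∀ v, u ≠ v → K.Adj u v := by
    intro u hu v huv
    have := hgdeg u hu
    have := hmin v
    have := hle v
    exact hore u v huv (by omega)
  have hbdeg : ∀ v ∈ bad, badᶜ.card ≤ K.degree v := by
    intro v hv
    refine card_le_card fun u hu => ?_
    rw [SimpleGraph.mem_neighborFinset]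
    exact (hmix u (mem_compl.1 hu) v (by rintro rfl; exact mem_compl.1 hu hv)).symm
  have htop : ∀ u v, u ≠ v → K.Adj u v := by
    intro u v huv
    by_cases hu : u ∈ bad
    · by_cases hv : v ∈ bad
      · have := hbdeg u hu
        have := hbdeg v hv
        exact hore u v huv (by omega)
      · exact (hmix v hv u huv.symm).symm
    · exact hmix u hu v huv
  refine hK.1 ⟨univ.toList, nodup_toList _, by simp, ?_⟩
  have h : (univ : Finset W).toList.Pairwise K.Adj :=
    (nodup_toList _).imp fun {a b} h => htop a b h
  exact h.isChain

/-! ### Tail bounds by counting -/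

/-- The sign `±1` of a Boolean. -/
def sgn (b : Bool) : ℝ := if b then 1 else -1

theorem sgn_beq (a b : Bool) : sgn (a == b) = sgn a * sgn b := by
  cases a <;> cases b <;> simp [sgn]

/-- Hoeffding's inequality for Rademacher sums, in counting form. -/
theorem card_signSum_le {ι : Type*} [Fintype ι] [DecidableEq ι] (a : ι → ℝ) (ha : ∀ j, |a j| ≤ 1)
    (t : ℝ) (ht : 0 ≤ t) [DecidablePred fun x : ι → Bool => ∑ j, a j * sgn (x j) ≤ -t] :
    (#{x : ι → Bool | ∑ j, a j * sgn (x j) ≤ -t} : ℝ) ≤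
      Fintype.card (ι → Bool) * Real.exp (-t ^ 2 / (2 * Fintype.card ι)) := by
  classical
  set q : ℝ := (Fintype.card ι : ℝ) with hq
  -- The exponential moment with the optimal parameter.
  set s : ℝ := t / q
  have hmoment : ∑ x : ι → Bool, Real.exp (-s * ∑ j, a j * sgn (x j)) ≤
      Fintype.card (ι → Bool) * Real.exp (s ^ 2 / 2 * q) := by
    have h1 : ∀ x : ι → Bool, Real.exp (-s * ∑ j, a j * sgn (x j)) =
        ∏ j, Real.exp (-s * (a j * sgn (x j))) := by
      intro x
      rw [mul_sum, Real.exp_sum]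
    simp_rw [h1]
    have h2 := prod_univ_sum (fun _ : ι => (univ : Finset Bool))
      fun j b => Real.exp (-s * (a j * sgn b))
    rw [Fintype.piFinset_univ] at h2
    rw [← h2]
    have h3 : ∀ j, ∑ b : Bool, Real.exp (-s * (a j * sgn b)) ≤ 2 * Real.exp (s ^ 2 / 2) := by
      intro j
      have h4 : ∑ b : Bool, Real.exp (-s * (a j * sgn b)) = 2 * Real.cosh (s * a j) := by
        rw [Real.cosh_eq]
        simp [sgn]
        ring
      have h5 : (s * a j) ^ 2 / 2 ≤ s ^ 2 / 2 := by
        have : a j ^ 2 ≤ 1 := (sq_le_one_iff_abs_le_one _).2 (ha j)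
        rw [mul_pow]
        nlinarith [sq_nonneg s]
      rw [h4]
      linarith [(Real.cosh_le_exp_half_sq (s * a j)).trans (Real.exp_le_exp.2 h5)]
    refine (prod_le_prod (fun j _ => sum_nonneg fun b _ => (Real.exp_pos _).le)
      fun j _ => h3 j).trans (le_of_eq ?_)
    rw [prod_const, mul_pow, ← Real.exp_nat_mul, card_univ, Fintype.card_fun, Fintype.card_bool]
    push_cast
    rw [mul_comm (Fintype.card ι : ℝ)]
  have hmarkov : (#{x : ι → Bool | ∑ j, a j * sgn (x j) ≤ -t} : ℝ) * Real.exp (s * t) ≤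
      ∑ x : ι → Bool, Real.exp (-s * ∑ j, a j * sgn (x j)) := by
    rw [← nsmul_eq_mul, ← sum_const]
    refine (sum_le_sum fun x hx => ?_).trans
      (sum_le_sum_of_subset_of_nonneg (filter_subset _ _) fun x _ _ => (Real.exp_pos _).le)
    have hx := (mem_filter.1 hx).2
    have hs : 0 ≤ s := by positivity
    exact Real.exp_le_exp.2 (by nlinarith)
  have hexp : Real.exp (-t ^ 2 / (2 * q)) * Real.exp (s * t) = Real.exp (s ^ 2 / 2 * q) := by
    rw [← Real.exp_add]
    congr 1
    by_cases h0 : q = 0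
    · simp [s, h0]
    · simp only [s]
      field_simp
      ring
  refine le_of_mul_le_mul_right ?_ (Real.exp_pos (s * t))
  rw [mul_assoc, hexp]
  exact hmarkov.trans hmoment

/-- The tail bound for a set `M` of vertices, each being one of the two elements of a pair `j`.
The two vertices of a pair have opposite signs, so that every pair contributes `0` or `±1`. -/
theorem card_pairSum_le {ι : Type*} [Fintype ι] [DecidableEq ι] (M : Finset (ι × Bool)) (c : ι → Bool)
    (t : ℝ) (ht : 0 ≤ t)
    [DecidablePred fun x : ι → Bool => ∑ p ∈ M, sgn ((c p.1 ^^ p.2) == x p.1) ≤ -t] :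
    (#{x : ι → Bool | ∑ p ∈ M, sgn ((c p.1 ^^ p.2) == x p.1) ≤ -t} : ℝ) ≤
      Fintype.card (ι → Bool) * Real.exp (-t ^ 2 / (2 * Fintype.card ι)) := by
  have h : ∀ x : ι → Bool, ∑ p ∈ M, sgn ((c p.1 ^^ p.2) == x p.1) =
      ∑ j, (∑ b, if (j, b) ∈ M then sgn (c j ^^ b) else 0) * sgn (x j) := by
    intro x
    rw [← sum_ite_mem_eq M, Fintype.sum_prod_type]
    refine sum_congr rfl fun j _ => ?_
    rw [sum_mul]
    refine sum_congr rfl fun b _ => ?_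
    rw [ite_mul, zero_mul, sgn_beq]
  simp_rw [h]
  refine card_signSum_le _ (fun j => ?_) t ht
  rw [Fintype.sum_bool]
  cases c j <;> split_ifs <;> simp [sgn]

/-- The first moment method for two families of events: with positive probability no event `B₂`
occurs and, for each `i`, at most an eighth of the events `B₁ i v` occur. -/
theorem exists_of_card_le {Ω κ V : Type*} [Fintype Ω] [Nonempty Ω] [Fintype κ] [Fintype V]
    (B₁ B₂ : κ → V → Ω → Prop)
    [∀ i v, DecidablePred (B₁ i v)] [∀ i v, DecidablePred (B₂ i v)] (p₁ p₂ : ℝ)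
    (h₁ : ∀ i v, (#{ω | B₁ i v ω} : ℝ) ≤ Fintype.card Ω * p₁)
    (h₂ : ∀ i v, (#{ω | B₂ i v ω} : ℝ) ≤ Fintype.card Ω * p₂)
    (hp : Fintype.card κ * (8 * p₁ + Fintype.card V * p₂) < 1) :
    ∃ ω, (∀ i, 8 * #{v | B₁ i v ω} ≤ Fintype.card V) ∧ ∀ i v, ¬ B₂ i v ω := by
  classical
  by_contra! hcon
  set n : ℝ := (Fintype.card V : ℝ) with hn
  rcases isEmpty_or_nonempty V with hV | hV
  · obtain ⟨i, v, -⟩ := hcon (Classical.arbitrary Ω) (by simp)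
    exact hV.elim v
  have hnpos : 0 < n := by
    rw [hn]; exact_mod_cast Fintype.card_pos
  let g : κ → V → Ω → ℝ := fun i v ω => (if B₁ i v ω then 8 / n else 0) + if B₂ i v ω then 1 else 0
  have hg : ∀ i v ω, 0 ≤ g i v ω := by
    intro i v ω
    simp only [g]
    split_ifs <;> positivity
  have hone : ∀ ω, 1 ≤ ∑ i, ∑ v, g i v ω := by
    intro ω
    by_cases h : ∀ i, 8 * #{v | B₁ i v ω} ≤ Fintype.card V
    · obtain ⟨i, v, hB⟩ := hcon ω h
      calc (1 : ℝ) ≤ g i v ω := by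
            simp only [g, if_pos hB]
            exact le_add_of_nonneg_left (by split_ifs <;> positivity)
        _ ≤ ∑ v, g i v ω := single_le_sum (f := fun v => g i v ω) (fun v _ => hg i v ω) (mem_univ v)
        _ ≤ _ := single_le_sum (f := fun i => ∑ v, g i v ω)
          (fun i _ => sum_nonneg fun v _ => hg i v ω) (mem_univ i)
    · push Not at h
      obtain ⟨i, hi⟩ := h
      calc (1 : ℝ) ≤ ∑ v, if B₁ i v ω then 8 / n else 0 := by
            rw [← sum_filter, sum_const, nsmul_eq_mul, ← mul_div_assoc, one_le_div hnpos]
            have : (Fintype.card V : ℝ) < 8 * #{v | B₁ i v ω} := by exact_mod_cast hi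
            linarith
        _ ≤ ∑ v, g i v ω := sum_le_sum fun v _ => by
            simp only [g]
            exact le_add_of_nonneg_right (by split_ifs <;> norm_num)
        _ ≤ _ := single_le_sum (f := fun i => ∑ v, g i v ω)
          (fun i _ => sum_nonneg fun v _ => hg i v ω) (mem_univ i)
  have hΩ : (0 : ℝ) < Fintype.card Ω := by exact_mod_cast Fintype.card_pos
  have hlow : (Fintype.card Ω : ℝ) ≤ ∑ ω, ∑ i, ∑ v, g i v ω := by
    have := sum_le_sum fun ω (_ : ω ∈ univ) => hone ω
    simpa using this
  have hup : ∑ ω, ∑ i, ∑ v, g i v ω ≤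
      Fintype.card κ * (n * (8 / n * (Fintype.card Ω * p₁) + Fintype.card Ω * p₂)) := by
    rw [sum_comm]
    have : ∀ i ∈ (univ : Finset κ), ∑ ω, ∑ v, g i v ω ≤
        n * (8 / n * (Fintype.card Ω * p₁) + Fintype.card Ω * p₂) := by
      intro i _
      rw [sum_comm]
      have : ∀ v ∈ (univ : Finset V), ∑ ω, g i v ω ≤
          8 / n * (Fintype.card Ω * p₁) + Fintype.card Ω * p₂ := by
        intro v _
        simp only [g]
        rw [sum_add_distrib, ← sum_filter, ← sum_filter, sum_const, sum_const, nsmul_eq_mul,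
          nsmul_eq_mul, mul_one, mul_comm]
        exact add_le_add (mul_le_mul_of_nonneg_left (h₁ i v) (by positivity)) (h₂ i v)
      refine (sum_le_card_nsmul _ _ _ this).trans_eq ?_
      rw [nsmul_eq_mul, card_univ]
    refine (sum_le_card_nsmul _ _ _ this).trans_eq ?_
    rw [nsmul_eq_mul, card_univ]
  have heq : (Fintype.card κ : ℝ) * (n * (8 / n * (Fintype.card Ω * p₁) + Fintype.card Ω * p₂)) =
      Fintype.card Ω * (Fintype.card κ * (8 * p₁ + n * p₂)) := by
    field_simp
  rw [heq] at hup
  nlinarith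

/-! ### Paths through halves of a dense graph -/

theorem exists_path_of_traceable {V : Type*} {G : SimpleGraph V} {S : Set V} (hS : S.Nonempty)
    (h : Traceable (G.induce S)) : ∃ P : GPath G, P.verts = S := by
  obtain ⟨l, hnd, hall, hch⟩ := h
  obtain ⟨w, hw⟩ := hS
  have hne : l.map Subtype.val ≠ [] := by
    rw [Ne, List.map_eq_nil_iff]
    exact List.ne_nil_of_mem (hall ⟨w, hw⟩)
  have hch' : (l.map Subtype.val).IsChain G.Adj := by
    rw [List.isChain_map]
    exact hch
  refine ⟨⟨_, _, ⟨SimpleGraph.Walk.ofSupport _ hne hch', ?_⟩⟩, ?_⟩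
  · rw [SimpleGraph.Walk.isPath_def, SimpleGraph.Walk.support_ofSupport]
    exact hnd.map Subtype.val_injective
  · ext x
    simp only [GPath.verts, SimpleGraph.Walk.support_ofSupport, Set.mem_ofPred_eq, List.mem_map]
    exact ⟨by rintro ⟨y, -, rfl⟩; exact y.2, fun hx => ⟨⟨x, hx⟩, hall _, rfl⟩⟩

theorem degree_induce_eq {V : Type*} [Fintype V] (G : SimpleGraph V) [DecidableRel G.Adj]
    (S : Set V) [DecidablePred (· ∈ S)] (v : S) [Fintype ((G.induce S).neighborSet v)] :
    (G.induce S).degree v = #{w ∈ G.neighborFinset v | w ∈ S} := by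
  classical
  rw [← SimpleGraph.card_neighborFinset_eq_degree, ← card_map (Function.Embedding.subtype (· ∈ S))]
  congr 1
  ext w
  simp only [mem_map, SimpleGraph.mem_neighborFinset, SimpleGraph.comap_adj, mem_filter,
    Function.Embedding.subtype_apply]
  exact ⟨by rintro ⟨y, hy, rfl⟩; exact ⟨hy, y.2⟩, fun h => ⟨⟨w, h.2⟩, h.1, rfl⟩⟩

/-- A set `S` of at most about half of the vertices is the vertex set of a path, if all vertices
have more than `n / 8` neighbours in `S`, and all but at most `n / 8` of them more than `n / 4`. -/
theorem exists_path_of_degree {V : Type*} [Fintype V] [Nonempty V] (G : SimpleGraph V)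
    [DecidableRel G.Adj] (S : Set V) [DecidablePred (· ∈ S)]
    (hS : 2 * #{v | v ∈ S} ≤ Fintype.card V + 1)
    (hbad : 8 * #{v | 4 * #{w ∈ G.neighborFinset v | w ∈ S} ≤ Fintype.card V} ≤ Fintype.card V)
    (hmin : ∀ v, Fintype.card V < 8 * #{w ∈ G.neighborFinset v | w ∈ S}) :
    ∃ P : GPath G, P.verts = S := by
  classical
  set n := Fintype.card V with hn
  have hnpos : 0 < n := Fintype.card_pos
  set bad : Finset V := {v | 4 * #{w ∈ G.neighborFinset v | w ∈ S} ≤ n} with hbaddef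
  have hm : Fintype.card S = #{v | v ∈ S} := Fintype.card_subtype _
  obtain ⟨v, hv⟩ : ∃ v, v ∉ bad := by
    by_contra! h
    have : bad = univ := eq_univ_iff_forall.2 h
    rw [this, card_univ] at hbad
    omega
  simp only [hbaddef, mem_filter, mem_univ, true_and, not_le] at hv
  have hle : #{w ∈ G.neighborFinset v | w ∈ S} ≤ #{v | v ∈ S} :=
    card_le_card (filter_subset_filter _ (subset_univ _))
  refine exists_path_of_traceable ?_ (traceable_of_degree (G.induce S) bad.card (by omega) ?_ ?_)
  · obtain ⟨w, hw⟩ := card_pos.1 (by omega : 0 < #{v | v ∈ S})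
    exact ⟨w, (mem_filter.1 hw).2⟩
  · refine card_le_card_of_injOn Subtype.val (fun w hw => ?_) Subtype.val_injective.injOn
    have hw := (mem_filter.1 (mem_coe.1 hw)).2
    rw [degree_induce_eq] at hw
    rw [mem_coe, hbaddef, mem_filter]
    exact ⟨mem_univ _, by omega⟩
  · intro w
    rw [degree_induce_eq]
    have := hmin w
    omega

/-! ### The random separating system -/

/-- Bit `i` of the word of a vertex, given by its pair `j` and its side `b` in the pair. The two
vertices of a pair get complementary words: the binary expansion of `j`, with all bits flipped
according to `b` and to the random sign `x j`. -/
def bit {q : ℕ} (x : Fin q → Bool) (i : ℕ) (p : Fin q × Bool) : Bool :=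
  ((p.1 : ℕ).testBit i ^^ p.2) == x p.1

/-- The top bit of `j` vanishes, so that the top bit of the word shows whether it was flipped. -/
theorem bit_injective {q k : ℕ} (hk : 1 ≤ k) (hq : q ≤ 2 ^ (k - 1)) (x : Fin q → Bool)
    {p p' : Fin q × Bool} (h : ∀ i < k, bit x i p = bit x i p') : p = p' := by
  obtain ⟨j, b⟩ := p
  obtain ⟨j', b'⟩ := p'
  simp only [bit] at h
  have htop : ∀ j : Fin q, ∀ i, k - 1 ≤ i → (j : ℕ).testBit i = false := fun j i hi =>
    Nat.testBit_lt_two_pow ((j.2.trans_le hq).trans_le (Nat.pow_le_pow_right (by norm_num) hi))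
  have h0 := h (k - 1) (by omega)
  rw [htop j _ le_rfl, htop j' _ le_rfl] at h0
  obtain rfl : j = j' := by
    refine Fin.ext (Nat.eq_of_testBit_eq fun i => ?_)
    rcases Nat.lt_or_ge i k with hi | hi
    · have h1 := h i hi
      generalize (j : ℕ).testBit i = y at *
      generalize (j' : ℕ).testBit i = y' at *
      generalize x j = z at *
      generalize x j' = z' at *
      revert h0 h1
      cases y <;> cases y' <;> cases z <;> cases z' <;> cases b <;> cases b' <;> decide
    · rw [htop j i (by omega), htop j' i (by omega)]
  generalize x j = z at *
  revert h0
  cases z <;> cases b <;> cases b' <;> simp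

/-- If the vertices of `G` embed into `q` pairs with `2 * q ≤ n + 1`, `q ≤ 2 ^ (k - 1)`, and the
expected number of exceptional events is small, then `k` paths separate the vertices. -/
theorem sp_le_of_pairs {V : Type*} [Fintype V] [Nonempty V] (G : SimpleGraph V)
    [DecidableRel G.Adj] {q k : ℕ} (e : V ↪ Fin q × Bool) (hk : 1 ≤ k) (hq : q ≤ 2 ^ (k - 1))
    (hqn : 2 * q ≤ Fintype.card V + 1) (T : ℝ) (hT : 0 ≤ T)
    (hdeg : ∀ v, (Fintype.card V : ℝ) / 2 + T ≤ G.degree v)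
    (hp : k * (8 * Real.exp (-T ^ 2 / (2 * q)) +
      Fintype.card V * Real.exp (-((Fintype.card V : ℝ) / 4) ^ 2 / (2 * q))) < 1) :
    sp G ≤ k := by
  classical
  set n := Fintype.card V with hn
  -- Twice the number of neighbours of `v` in the `i`-th set, minus the degree of `v`.
  let X : Fin k → V → (Fin q → Bool) → ℝ := fun i v x =>
    ∑ p ∈ (G.neighborFinset v).map e, sgn (((p.1 : ℕ).testBit i ^^ p.2) == x p.1)
  have htail : ∀ t : ℝ, 0 ≤ t → ∀ i v, (#{x | X i v x ≤ -t} : ℝ) ≤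
      Fintype.card (Fin q → Bool) * Real.exp (-t ^ 2 / (2 * q)) := by
    intro t ht i v
    have := card_pairSum_le ((G.neighborFinset v).map e) (fun j => (j : ℕ).testBit i) t ht
    rwa [Fintype.card_fin] at this
  obtain ⟨x, hx₁, hx₂⟩ := exists_of_card_le (fun i v x => X i v x ≤ -T)
    (fun i v x => X i v x ≤ -((n : ℝ) / 4)) _ _ (htail T hT) (htail (n / 4) (by positivity))
    (by rwa [Fintype.card_fin])
  let S : Fin k → Set V := fun i => {v | bit x i (e v) = true}
  have hX : ∀ i v, X i v x = 2 * #{w ∈ G.neighborFinset v | w ∈ S i} - G.degree v := by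
    intro i v
    have h1 : X i v x = ∑ w ∈ G.neighborFinset v, ((if w ∈ S i then 2 else 0) - 1 : ℝ) := by
      simp only [X]
      rw [sum_map]
      refine sum_congr rfl fun w _ => ?_
      change sgn (bit x i (e w)) = (if bit x i (e w) = true then 2 else 0) - 1
      cases bit x i (e w) <;> norm_num [sgn]
    rw [h1, sum_sub_distrib, ← sum_filter, sum_const, sum_const,
      SimpleGraph.card_neighborFinset_eq_degree]
    simp [mul_comm]
  have hcard : ∀ i, #{v | v ∈ S i} ≤ q := by
    intro i
    have : #{v | v ∈ S i} ≤ (univ : Finset (Fin q)).card := by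
      refine card_le_card_of_injOn (fun v => (e v).1) (fun v _ => by simp) ?_
      intro v hv w hw hvw
      have hv := (mem_filter.1 (mem_coe.1 hv)).2
      have hw := (mem_filter.1 (mem_coe.1 hw)).2
      change bit x i (e v) = true at hv
      change bit x i (e w) = true at hw
      refine e.injective (Prod.ext hvw ?_)
      simp only [bit, beq_iff_eq] at hv hw hvw
      rw [hvw] at hv
      simpa using hv.trans hw.symm
    simpa using this
  have hpath : ∀ i, ∃ P : GPath G, P.verts = S i := by
    intro i
    refine exists_path_of_degree G (S i) (by have := hcard i; omega) ?_ ?_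
    · refine (Nat.mul_le_mul_left 8 (card_le_card fun v hv => ?_)).trans (hx₁ i)
      have hv := (mem_filter.1 hv).2
      refine mem_filter.2 ⟨mem_univ _, ?_⟩
      have hv' : 4 * (#{w ∈ G.neighborFinset v | w ∈ S i} : ℝ) ≤ n := by exact_mod_cast hv
      rw [hX]
      linarith [hdeg v]
    · intro v
      have h1 := hx₂ i v
      rw [hX, not_le] at h1
      have h2 : (n : ℝ) < 8 * #{w ∈ G.neighborFinset v | w ∈ S i} := by linarith [hdeg v]
      exact_mod_cast h2
  choose P hP using hpath
  have hsep : IsVertexSeparating (univ.image P) := by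
    intro u v huv
    obtain ⟨i, hi, hne⟩ : ∃ i, i < k ∧ bit x i (e u) ≠ bit x i (e v) := by
      by_contra! h
      exact huv (e.injective (bit_injective hk hq x h))
    refine ⟨S ⟨i, hi⟩, ⟨P ⟨i, hi⟩, mem_image_of_mem _ (mem_univ _), hP _⟩, ?_⟩
    change (bit x i (e u) = true ∧ ¬ bit x i (e v) = true) ∨
      (¬ bit x i (e u) = true ∧ bit x i (e v) = true)
    revert hne
    cases bit x i (e u) <;> cases bit x i (e v) <;> simp
  calc sp G ≤ (univ.image P).card := (sp_spec G).2 ⟨_, hsep, rfl⟩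
    _ ≤ k := card_image_le.trans (by simp)

/-! ### Numerical estimates -/

/-- The bound on the minimum degree is below `n` only if `n` is large. -/
theorem six_le_log_of_lt {n : ℝ} (hn : 3 ≤ n)
    (h : n / 2 + 9 * Real.sqrt (n * Real.log (Real.log n)) < n) : 500 ≤ n ∧ 6 ≤ Real.log n := by
  have hlog3 := Real.log_three_gt_d9
  have hlog : 1.0986 ≤ Real.log n :=
    (by linarith : (1.0986 : ℝ) ≤ Real.log 3).trans (Real.log_le_log (by norm_num) hn)
  have key : 324 * Real.log (Real.log n) < n := by
    by_contra! hle
    have h1 : (n / 18) ^ 2 ≤ n * Real.log (Real.log n) := by nlinarith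
    have h2 := Real.le_sqrt_of_sq_le h1
    linarith
  -- A lower bound for `n` yields a better one through `key`; three rounds are enough.
  have step : ∀ m a : ℝ, 0 < a → a ≤ Real.log n → m ≤ 324 * Real.log a → m < n :=
    fun m a ha h1 h2 => (h2.trans (by have := Real.log_le_log ha h1; linarith)).trans_lt key
  have elog : ∀ (m : ℕ) (b : ℝ), (2.7182818286 : ℝ) ^ m ≤ b → b ≤ n → (m : ℝ) ≤ Real.log n := by
    intro m b hb hbn
    rw [Real.le_log_iff_exp_le (by linarith), ← Real.exp_one_pow]
    exact (pow_le_pow_left₀ (Real.exp_pos 1).le Real.exp_one_lt_d9.le m).trans (hb.trans hbn)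
  have h1 : 25 < n := step 25 1.0986 (by norm_num) hlog (by
    have := Real.one_sub_inv_le_log_of_pos (by norm_num : (0 : ℝ) < 1.0986)
    norm_num at this ⊢
    linarith)
  have h2 : 350 < n := step 350 3 (by norm_num) (elog 3 25 (by norm_num) h1.le) (by linarith)
  have h3 : 500 < n := step 500 5 (by norm_num) (elog 5 350 (by norm_num) h2.le) (by
    have h5 : Real.log 3 + Real.log (5 / 3) = Real.log 5 := by
      rw [← Real.log_mul (by norm_num) (by norm_num)]; norm_num
    have := Real.one_sub_inv_le_log_of_pos (by norm_num : (0 : ℝ) < 5 / 4)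
    have := Real.one_sub_inv_le_log_of_pos (by norm_num : (0 : ℝ) < 4 / 3)
    have h6 : Real.log (5 / 4) + Real.log (4 / 3) = Real.log (5 / 3) := by
      rw [← Real.log_mul (by norm_num) (by norm_num)]; norm_num
    norm_num at *
    linarith)
  exact ⟨h3.le, by exact_mod_cast elog 6 500 (by norm_num) h3.le⟩

theorem clog_two_le {n : ℕ} (hn : 2 ≤ n) (hlog : 6 ≤ Real.log n) :
    (Nat.clog 2 n : ℝ) ≤ 2 * Real.log n := by
  have h1 : (2 : ℝ) ^ (Nat.clog 2 n - 1) < n := by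
    exact_mod_cast Nat.pow_pred_clog_lt_self (b := 2) (by norm_num) (by omega : 1 < n)
  have h2 := Real.log_lt_log (by positivity) h1
  rw [Real.log_pow, Nat.cast_sub (Nat.clog_pos (by norm_num) hn)] at h2
  have := Real.log_two_gt_d9
  push_cast at h2
  nlinarith

/-- The expected number of exceptional events is less than one. -/
theorem exceptional_lt_one {n q k : ℕ} (hn : 500 ≤ n) (hq : 1 ≤ q) (hqn : 2 * q ≤ n + 1)
    (hlog : 6 ≤ Real.log n) (hk : (k : ℝ) ≤ 2 * Real.log n) (hkn : k ≤ n) :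
    k * (8 * Real.exp (-(8 * Real.sqrt (n * Real.log (Real.log n))) ^ 2 / (2 * q)) +
      n * Real.exp (-((n : ℝ) / 4) ^ 2 / (2 * q))) < 1 := by
  set l := Real.log n with hl
  have hn' : (500 : ℝ) ≤ n := by exact_mod_cast hn
  have hq' : (1 : ℝ) ≤ q := by exact_mod_cast hq
  have hqn' : 2 * (q : ℝ) ≤ n + 1 := by exact_mod_cast hqn
  have hkn' : (k : ℝ) ≤ n := by exact_mod_cast hkn
  have hll : 0 ≤ Real.log l := Real.log_nonneg (by linarith)
  have h1 : Real.exp (-(8 * Real.sqrt (n * Real.log l)) ^ 2 / (2 * q)) ≤ (l ^ 4)⁻¹ := by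
    have h : -(8 * Real.sqrt (n * Real.log l)) ^ 2 / (2 * q) ≤ -(4 * Real.log l) := by
      rw [mul_pow, Real.sq_sqrt (by positivity), div_le_iff₀ (by positivity)]
      nlinarith [mul_nonneg hll (by linarith : (0 : ℝ) ≤ n - 1)]
    refine (Real.exp_le_exp.2 h).trans_eq ?_
    rw [Real.exp_neg, mul_comm, Real.exp_mul, Real.exp_log (by linarith)]
    norm_cast
  have h2 : Real.exp (-((n : ℝ) / 4) ^ 2 / (2 * q)) ≤ 1 / (2 * n ^ 2) := by
    have h : -((n : ℝ) / 4) ^ 2 / (2 * q) ≤ -(n / 17) := by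
      rw [div_le_iff₀ (by positivity)]
      nlinarith
    refine (Real.exp_le_exp.2 h).trans ?_
    rw [Real.exp_neg, ← one_div]
    refine one_div_le_one_div_of_le (by positivity) (le_trans ?_
      (Real.pow_div_factorial_le_exp ((n : ℝ) / 17) (by positivity) 6))
    have h4 : (500 : ℝ) ^ 4 ≤ n ^ 4 := pow_le_pow_left₀ (by norm_num) hn' 4
    rw [div_pow, div_div, le_div_iff₀ (by positivity)]
    norm_num [Nat.factorial] at h4 ⊢
    nlinarith [sq_nonneg ((n : ℝ))]
  have h3 : (k : ℝ) * (8 * (l ^ 4)⁻¹) ≤ 1 / 4 := by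
    calc (k : ℝ) * (8 * (l ^ 4)⁻¹) ≤ 2 * l * (8 * (l ^ 4)⁻¹) := by gcongr
      _ = 16 / l ^ 3 := by field_simp; norm_num
      _ ≤ 16 / 6 ^ 3 := by gcongr
      _ ≤ 1 / 4 := by norm_num
  have h4 : (k : ℝ) * (n * (1 / (2 * n ^ 2))) ≤ 1 / 2 := by
    calc (k : ℝ) * (n * (1 / (2 * n ^ 2))) ≤ n * (n * (1 / (2 * n ^ 2))) := by gcongr
      _ = 1 / 2 := by field_simp
  calc _ ≤ (k : ℝ) * (8 * (l ^ 4)⁻¹ + n * (1 / (2 * n ^ 2))) := by gcongr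
    _ ≤ 1 / 4 + 1 / 2 := by rw [mul_add]; exact add_le_add h3 h4
    _ < 1 := by norm_num

theorem f_le {n : ℕ} (hn : 3 ≤ n) :
    (f n : ℝ) ≤ (n : ℝ) / 2 + 9 * Real.sqrt ((n : ℝ) * Real.log (Real.log (n : ℝ))) := by
  have hne : Nonempty (Fin n) := ⟨⟨0, by omega⟩⟩
  set B := (n : ℝ) / 2 + 9 * Real.sqrt ((n : ℝ) * Real.log (Real.log (n : ℝ))) with hB
  rcases le_or_gt (n : ℝ) B with hnB | hnB
  · -- No graph on `n` vertices has minimum degree `n`.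
    refine le_trans ?_ hnB
    have : ForcesOptimal n n := by
      intro G _ h
      have h2 := G.minDegree_lt_card
      rw [Fintype.card_fin] at h2
      omega
    exact_mod_cast (f_spec n (by omega)).2 this
  obtain ⟨h500, hlog⟩ := six_le_log_of_lt (by exact_mod_cast hn) hnB
  have h500' : 500 ≤ n := by exact_mod_cast h500
  have hclog := clog_two_le (by omega) hlog
  have hpos : 1 ≤ Nat.clog 2 n := Nat.clog_pos (by norm_num) (by omega)
  refine le_trans ?_ (Nat.floor_le (by positivity : 0 ≤ B))
  refine Nat.cast_le.2 ((f_spec n (by omega)).2 ?_)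
  intro G _ hG
  have hceil : ⌈Real.logb 2 (n : ℝ)⌉₊ = Nat.clog 2 n := by
    exact_mod_cast Real.natCeil_logb_natCast 2 n
  rw [hceil]
  refine le_antisymm ?_ (by simpa using clog_card_le_sp G)
  let e : Fin n ↪ Fin ((n + 1) / 2) × Bool :=
    ⟨fun v => (⟨(v : ℕ) / 2, by omega⟩, decide ((v : ℕ) % 2 = 1)), fun v w h => by
      simp only [Prod.mk.injEq, Fin.mk.injEq, decide_eq_decide] at h
      omega⟩
  refine sp_le_of_pairs G e hpos ?_ (by rw [Fintype.card_fin]; omega)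
    (8 * Real.sqrt ((n : ℝ) * Real.log (Real.log (n : ℝ)))) (by positivity) ?_ ?_
  · have h1 : n ≤ 2 ^ Nat.clog 2 n := Nat.le_pow_clog (by norm_num) n
    rw [← Nat.succ_pred_eq_of_pos hpos, pow_succ, Nat.pred_eq_sub_one] at h1
    omega
  · -- The rounding of `B` is absorbed by replacing the constant `9` by `8`.
    intro v
    have h1 : B < G.degree v + 1 :=
      (Nat.lt_floor_add_one B).trans_le (by
        exact_mod_cast Nat.succ_le_succ (hG.trans (G.minDegree_le_degree v)))
    have h2 : 1 ≤ Real.sqrt ((n : ℝ) * Real.log (Real.log (n : ℝ))) := by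
      rw [Real.one_le_sqrt]
      have := Real.one_sub_inv_le_log_of_pos (by linarith : 0 < Real.log (n : ℝ))
      have h3 : (Real.log (n : ℝ))⁻¹ ≤ 6⁻¹ := inv_anti₀ (by norm_num) hlog
      nlinarith
    rw [Fintype.card_fin]
    linarith
  · rw [Fintype.card_fin]
    exact exceptional_lt_one h500' (by omega) (by omega) hlog hclog
      (Nat.clog_le_of_le_pow Nat.lt_two_pow_self.le)

end VertexSep

theorem proposition1p4 (n : ℕ) :
    (1 ≤ n → n ≠ 2 → n ≠ 3 → n ≠ 5 → ⌈((n : ℝ) - 1) / 2⌉ ≤ (VertexSep.f n : ℤ)) ∧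
    (3 ≤ n → (VertexSep.f n : ℝ) ≤
      (n : ℝ) / 2 + 9 * Real.sqrt ((n : ℝ) * Real.log (Real.log (n : ℝ)))) :=
  ⟨VertexSep.ceil_half_le_f, VertexSep.f_le⟩
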